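/- Let $n\ge 1$, let $\mathrm{Conf}(n)=\{(x_1,\dots,x_n)\in(\mathbb R^3)^n : x_i\ne x_j \text{ for } i\ne j\}$, and fix any base point $q\in\mathrm{Conf}(n)$. Write $[X,Y]$ for the set of pointed homotopy classes of pointed maps $X\to Y$, $\Omega Y$ for the based loop space, $\Sigma X$ for the reduced suspension, and $\mathbb T^k=(\mathbb R/\mathbb Z)^k$ with base point $0$; for $k\ge 1$ let $\mathbb T^{k}_{(k-1)}$ be its $(k-1)$-skeleton, i.e. the set of points having at least one coordinate equal to $0$ (and let $\mathbb T^0/\mathbb T^0_{(-1)}$ be read as a point). Let $T(n)=[\mathbb T^{n-1},\Omega\,\mathrm{Conf}(n)]=[\Sigma\mathbb T^{n-1},\mathrm{Conf}(n)]$, the two sets being identified by adjunction. For the top multi-index $N=(1,\dots,n-1)$ let $S^N=\mathbb T^{n-1}/\mathbb T^{n-1}_{(n-2)}$ and $\pi_N(\Omega\,\mathrm{Conf}(n))=[S^N,\Omega\,\mathrm{Conf}(n)]$. Let $j_N:\mathbb T^{n-1}\to S^N$ be the quotient projection, and let $p:\mathbb T^n\to \mathbb T^n/\big((\mathbb T^{n-1}\times\{0\})\cup(\{0\}\times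 S^1)\big)=\Sigma\mathbb T^{n-1}$ be the quotient projection. Then the composition $$\pi_N(\Omega\,\mathrm{Conf}(n))\xrightarrow{\ j_N^\#\ }T(n)\xrightarrow{\ p^\#\ }[\mathbb T^n,\mathrm{Conf}(n)],\qquad j_N^\#[f]=[f\circ j_N],\quad p^\#[g]=[g\circ p],$$ is injective. Equivalently, the collapse map $\mathbb T^n\to\mathbb T^n/\mathbb T^n_{(n-1)}\cong [0,1]^n/\partial[0,1]^n\cong S^n$ induces an injection $q^\#:\pi_n(\mathrm{Conf}(n),q)\to[\mathbb T^n,\mathrm{Conf}(n)]$; moreover, there is a bijection $\Phi:\pi_N(\Omega\,\mathrm{Conf}(n))\to\pi_n(\mathrm{Conf}(n),q)$ with $p^\#\circ j_N^\#=q^\#\circ\Phi$. -/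

import Mathlib

open Topology unitInterval

noncomputable section

/-! ### Homotopy classes -/

/-- Continuous maps `f : A → Y` of pairs `(A, S) → (Y, {y})`. -/
abbrev RelMap (A : Type*) [TopologicalSpace A] (S : Set A)
    (Y : Type*) [TopologicalSpace Y] (y : Y) : Type _ :=
  {f : C(A, Y) // ∀ a ∈ S, f a = y}

/-- Homotopy of maps of pairs `(A, S) → (Y, {y})`, through such maps. -/
def relSetoid (A : Type*) [TopologicalSpace A] (S : Set A)
    (Y : Type*) [TopologicalSpace Y] (y : Y) : Setoid (RelMap A S Y y) where
  r f g := f.1.HomotopicRel g.1 S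
  iseqv := ⟨fun _ => .refl _, fun h => h.symm, fun h k => h.trans k⟩

/-- The set `[(A, S); (Y, y)]` of homotopy classes of maps of pairs. -/
def RelClasses (A : Type*) [TopologicalSpace A] (S : Set A)
    (Y : Type*) [TopologicalSpace Y] (y : Y) : Type _ :=
  Quotient (relSetoid A S Y y)

/-- The set `[X, Y]` of pointed homotopy classes of pointed maps `(X, x) → (Y, y)`. -/
abbrev PtdClasses (X : Type*) [TopologicalSpace X] (x : X)
    (Y : Type*) [TopologicalSpace Y] (y : Y) : Type _ :=
  RelClasses X {x} Y y

/-- The map `h^# : [X', Y] → [X, Y]`, `[f] ↦ [f ∘ h]`, induced by a pointed map `h : X → X'`. -/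
def precomp {X X' Y : Type*} [TopologicalSpace X] [TopologicalSpace X'] [TopologicalSpace Y]
    {x : X} {x' : X'} {y : Y} (h : C(X, X')) (hx : h x = x') :
    PtdClasses X' x' Y y → PtdClasses X x Y y :=
  Quotient.map' (s₁ := relSetoid X' {x'} Y y) (s₂ := relSetoid X {x} Y y)
    (fun f => ⟨f.1.comp h, by rintro _ rfl; exact f.2 _ hx⟩) (by
      rintro f g ⟨H⟩
      exact ⟨{ toFun := fun z => H (z.1, h z.2)
               continuous_toFun := by fun_prop
               map_zero_left := fun a => H.apply_zero (h a)
               map_one_left := fun a => H.apply_one (h a)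
               prop' := by
                intro t a ha
                exact H.prop' t (h a) (by rw [Set.mem_singleton_iff.1 ha]; exact hx) }⟩)

/-! ### Quotients of the form `X / A` -/

/-- The equivalence relation on `X` identifying all the points of `A` with each other. -/
def collapseSetoid {X : Type*} (A : Set X) : Setoid X where
  r x y := x = y ∨ (x ∈ A ∧ y ∈ A)
  iseqv := ⟨fun _ => .inl rfl, by
    rintro x y (rfl | ⟨h, k⟩)
    exacts [.inl rfl, .inr ⟨k, h⟩], by
    rintro x y z (rfl | ⟨h, k⟩) (rfl | ⟨h', k'⟩)
    exacts [.inl rfl, .inr ⟨h', k'⟩, .inr ⟨h, k⟩, .inr ⟨h, k'⟩]⟩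

/-- The quotient space `X / A` (with the quotient topology). -/
abbrev Collapse {X : Type*} (A : Set X) : Type _ := Quotient (collapseSetoid A)

/-- The quotient projection `X → X / A`. -/
def Collapse.proj {X : Type*} [TopologicalSpace X] (A : Set X) : C(X, Collapse A) :=
  ⟨Quotient.mk _, continuous_quotient_mk'⟩

theorem Collapse.proj_eq_iff {X : Type*} [TopologicalSpace X] {A : Set X} {x y : X} :
    Collapse.proj A x = Collapse.proj A y ↔ x = y ∨ (x ∈ A ∧ y ∈ A) :=
  Quotient.eq (r := collapseSetoid A)

/-- `π : P → B` is (up to a homeomorphism of `B`) the collapse of the nonempty subset `S`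
to the point `b`. -/
structure IsCollapse {P B : Type*} [TopologicalSpace P] [TopologicalSpace B]
    (π : C(P, B)) (S : Set P) (b : B) : Prop where
  isQuotientMap : IsQuotientMap π
  nonempty : S.Nonempty
  map_eq : ∀ a ∈ S, π a = b
  inj : ∀ a a', π a = π a' → a = a' ∨ (a ∈ S ∧ a' ∈ S)

theorem IsCollapse.factors {P B Y : Type*} [TopologicalSpace P] [TopologicalSpace B]
    [TopologicalSpace Y] {π : C(P, B)} {S : Set P} {b : B} (h : IsCollapse π S b) {y : Y}
    (f : RelMap P S Y y) : Function.FactorsThrough f.1 π := by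
  intro a a' e
  rcases h.inj a a' e with rfl | ⟨k, k'⟩
  · rfl
  · rw [f.2 a k, f.2 a' k']

/-- The map `B → Y` induced by `f : P → Y`, where `f` is constant on the collapsed subset. -/
def IsCollapse.lift {P B Y : Type*} [TopologicalSpace P] [TopologicalSpace B]
    [TopologicalSpace Y] {π : C(P, B)} {S : Set P} {b : B} (h : IsCollapse π S b) {y : Y}
    (f : RelMap P S Y y) : C(B, Y) :=
  h.isQuotientMap.lift f.1 (h.factors f)

theorem IsCollapse.lift_apply {P B Y : Type*} [TopologicalSpace P] [TopologicalSpace B]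
    [TopologicalSpace Y] {π : C(P, B)} {S : Set P} {b : B} (h : IsCollapse π S b) {y : Y}
    (f : RelMap P S Y y) (a : P) : h.lift f (π a) = f.1 a :=
  DFunLike.congr_fun (h.isQuotientMap.lift_comp f.1 (h.factors f)) a

/-- A collapse `π : P → B` of `S` to `b` induces a bijection `[(P, S); (Y, y)] ≅ [B, Y]`;
its inverse is `[f] ↦ [f ∘ π]`. -/
def IsCollapse.equiv {P B Y : Type*} [TopologicalSpace P] [TopologicalSpace B]
    [TopologicalSpace Y] {π : C(P, B)} {S : Set P} {b : B} (h : IsCollapse π S b) (y : Y) :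
    RelClasses P S Y y ≃ PtdClasses B b Y y where
  toFun := Quotient.map' (s₁ := relSetoid P S Y y) (s₂ := relSetoid B {b} Y y)
    (fun f => ⟨h.lift f, by
        intro c hc
        obtain ⟨a, ha⟩ := h.nonempty
        obtain rfl : c = π a := (Set.mem_singleton_iff.1 hc).trans (h.map_eq a ha).symm
        exact (h.lift_apply f a).trans (f.2 a ha)⟩) (by
      rintro f g ⟨H⟩
      have key : ∀ t a a', π a = π a' → H (t, a) = H (t, a') := by
        intro t a a' e
        rcases h.inj a a' e with rfl | ⟨k, k'⟩
        · rfl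
        · rw [H.eq_fst t k, H.eq_fst t k', f.2 a k, f.2 a' k']
      have hH : ∀ t a, H (t, Function.surjInv h.isQuotientMap.surjective (π a)) = H (t, a) :=
        fun t a => key t _ _ (Function.surjInv_eq _ _)
      refine ⟨{ toFun := fun z => H (z.1, Function.surjInv h.isQuotientMap.surjective z.2)
                continuous_toFun := ?_
                map_zero_left := ?_
                map_one_left := ?_
                prop' := ?_ }⟩
      · refine h.isQuotientMap.continuous_lift_prod_right ?_
        simp only [hH]
        exact H.continuous
      · intro c
        obtain ⟨a, rfl⟩ := h.isQuotientMap.surjective c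
        exact ((hH 0 a).trans (H.apply_zero a)).trans (h.lift_apply f a).symm
      · intro c
        obtain ⟨a, rfl⟩ := h.isQuotientMap.surjective c
        exact ((hH 1 a).trans (H.apply_one a)).trans (h.lift_apply g a).symm
      · intro t c hc
        obtain ⟨a, ha⟩ := h.nonempty
        obtain rfl : c = π a := (Set.mem_singleton_iff.1 hc).trans (h.map_eq a ha).symm
        exact ((hH t a).trans (H.eq_fst t ha)).trans (h.lift_apply f a).symm)
  invFun := Quotient.map' (s₁ := relSetoid B {b} Y y) (s₂ := relSetoid P S Y y)
    (fun f => ⟨f.1.comp π, fun a ha => f.2 _ (h.map_eq a ha)⟩) (by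
      rintro f g ⟨H⟩
      exact ⟨{ toFun := fun z => H (z.1, π z.2)
               continuous_toFun := by fun_prop
               map_zero_left := fun a => H.apply_zero (π a)
               map_one_left := fun a => H.apply_one (π a)
               prop' := fun t a ha => H.prop' t (π a) (h.map_eq a ha) }⟩)
  left_inv := by
    rintro ⟨f⟩
    exact congrArg (Quotient.mk (relSetoid P S Y y)) (Subtype.ext (ContinuousMap.ext (h.lift_apply f)))
  right_inv := by
    rintro ⟨f⟩
    refine congrArg (Quotient.mk (relSetoid B {b} Y y)) (Subtype.ext (ContinuousMap.ext ?_))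
    intro c
    obtain ⟨a, rfl⟩ := h.isQuotientMap.surjective c
    exact h.lift_apply _ a

/-! ### The circle, reduced suspensions and loop spaces -/

/-- The parametrization of the circle `ℝ / ℤ` by the unit interval. -/
def circleParam : C(I, UnitAddCircle) :=
  ⟨fun t => ((t : ℝ) : UnitAddCircle), by
    exact (AddCircle.continuous_mk' 1).comp continuous_subtype_val⟩

theorem circleParam_zero : circleParam 0 = 0 := by
  change ((0 : ℝ) : UnitAddCircle) = 0
  simp

theorem circleParam_one : circleParam 1 = 0 :=
  AddCircle.coe_period 1

theorem circleParam_surjective : Function.Surjective circleParam := by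
  intro c
  obtain ⟨x, hx, rfl⟩ := AddCircle.coe_image_Icc_eq (1 : ℝ) 0 |>.symm ▸ Set.mem_univ c
  exact ⟨⟨x, hx.1, by simpa using hx.2⟩, rfl⟩

theorem circleParam_inj {s t : I} (h : circleParam s = circleParam t) :
    s = t ∨ ((s = 0 ∨ s = 1) ∧ (t = 0 ∨ t = 1)) := by
  have key : ∀ t : I, t = 1 ∨ (t : ℝ) ∈ Set.Ico (0 : ℝ) (0 + 1) := by
    intro t
    rcases eq_or_lt_of_le t.2.2 with e | e
    · exact .inl (Subtype.ext e)
    · exact .inr ⟨t.2.1, by simpa using e⟩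
  have zero : ∀ t : I, (t : ℝ) ∈ Set.Ico (0 : ℝ) (0 + 1) → circleParam t = 0 → t = 0 := by
    intro t ht h
    rw [← circleParam_zero] at h
    exact Subtype.ext ((AddCircle.coe_eq_coe_iff_of_mem_Ico (p := (1 : ℝ)) (a := 0) ht
      (by simp)).1 h)
  rcases key s with rfl | hs <;> rcases key t with rfl | ht
  · exact .inl rfl
  · exact .inr ⟨.inr rfl, .inl (zero t ht (h.symm.trans circleParam_one))⟩
  · exact .inr ⟨.inl (zero s hs (h.trans circleParam_one)), .inr rfl⟩
  · exact .inl (Subtype.ext ((AddCircle.coe_eq_coe_iff_of_mem_Ico hs ht).1 h))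

theorem circleParam_eq_zero {t : I} : circleParam t = 0 ↔ t = 0 ∨ t = 1 := by
  constructor
  · intro h
    rcases circleParam_inj (h.trans circleParam_zero.symm) with h | h
    exacts [.inl h, h.1]
  · rintro (rfl | rfl)
    exacts [circleParam_zero, circleParam_one]

/-- The reduced suspension `ΣX = X ∧ S¹ = (X × S¹) / (X × {0} ∪ {x} × S¹)`. -/
abbrev Susp (X : Type*) (x : X) : Type _ :=
  Collapse {z : X × UnitAddCircle | z.1 = x ∨ z.2 = 0}

/-- The projection `X × S¹ → ΣX`. -/
def Susp.proj {X : Type*} [TopologicalSpace X] (x : X) : C(X × UnitAddCircle, Susp X x) :=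
  Collapse.proj _

/-- The base point of `ΣX`. -/
def Susp.base {X : Type*} [TopologicalSpace X] (x : X) : Susp X x := Susp.proj x (x, 0)

/-- The quotient map `X × [0,1] → ΣX`. -/
def Susp.cyl {X : Type*} [TopologicalSpace X] (x : X) : C(X × I, Susp X x) :=
  (Susp.proj x).comp ((ContinuousMap.id X).prodMap circleParam)

theorem Susp.isCollapse {X : Type*} [TopologicalSpace X] (x : X) :
    IsCollapse (Susp.cyl x) {z : X × I | z.1 = x ∨ z.2 = 0 ∨ z.2 = 1} (Susp.base x) where
  isQuotientMap := by
    have h1 : IsProperMap (circleParam : I → UnitAddCircle) := circleParam.continuous.isProperMap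
    have h2 : IsProperMap (Prod.map (id : X → X) circleParam) :=
      IsProperMap.prodMap (Homeomorph.refl X).isProperMap h1
    have h3 : IsQuotientMap (Prod.map (id : X → X) circleParam) :=
      h2.isClosedMap.isQuotientMap h2.continuous
        (Function.surjective_id.prodMap circleParam_surjective)
    exact (isQuotientMap_quot_mk : IsQuotientMap (Susp.proj x)).comp h3
  nonempty := ⟨(x, 0), .inl rfl⟩
  map_eq := by
    rintro ⟨a, t⟩ h
    refine Collapse.proj_eq_iff.2 (.inr ⟨?_, .inl rfl⟩)
    exact h.imp id circleParam_eq_zero.2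
  inj := by
    rintro ⟨a, s⟩ ⟨b, t⟩ h
    rcases Collapse.proj_eq_iff.1 h with h | ⟨h, k⟩
    · obtain ⟨h1, h2⟩ := Prod.ext_iff.1 h
      obtain rfl : a = b := h1
      rcases circleParam_inj h2 with rfl | ⟨k, k'⟩
      exacts [.inl rfl, .inr ⟨.inr k, .inr k'⟩]
    · exact .inr ⟨h.imp id circleParam_eq_zero.1, k.imp id circleParam_eq_zero.1⟩

/-- The exponential law for pairs: a map `f : X → ΩY` corresponds to
`X × [0,1] → Y`, `(u, t) ↦ f(u)(t)`. -/
def curryEquiv {X Y : Type*} [TopologicalSpace X] [TopologicalSpace Y] (x : X) (y : Y) :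
    PtdClasses X x (LoopSpace Y y) (Path.refl y) ≃
      RelClasses (X × I) {z | z.1 = x ∨ z.2 = 0 ∨ z.2 = 1} Y y where
  toFun := Quotient.map' (s₁ := relSetoid X {x} (LoopSpace Y y) (Path.refl y))
    (s₂ := relSetoid (X × I) {z | z.1 = x ∨ z.2 = 0 ∨ z.2 = 1} Y y)
    (fun f => ⟨⟨fun z => f.1 z.1 z.2, by fun_prop⟩, by
      rintro ⟨a, t⟩ (h | h | h)
      · obtain rfl : a = x := h
        simp [f.2 a rfl]
      · obtain rfl : t = 0 := h
        simp
      · obtain rfl : t = 1 := h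
        simp⟩) (by
      rintro f g ⟨H⟩
      exact ⟨{ toFun := fun z => H (z.1, z.2.1) z.2.2
               continuous_toFun := by fun_prop
               map_zero_left := fun a => by simp
               map_one_left := fun a => by simp
               prop' := by
                rintro r ⟨a, t⟩ (h | h | h)
                · obtain rfl : a = x := h
                  have := H.eq_fst r (Set.mem_singleton a)
                  exact congrArg (fun γ : LoopSpace Y y => γ t) this
                · obtain rfl : t = 0 := h
                  simp
                · obtain rfl : t = 1 := h
                  simp }⟩)
  invFun := Quotient.map' (s₁ := relSetoid (X × I) {z | z.1 = x ∨ z.2 = 0 ∨ z.2 = 1} Y y)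
    (s₂ := relSetoid X {x} (LoopSpace Y y) (Path.refl y))
    (fun f => ⟨⟨fun a =>
        { toFun := fun t => f.1 (a, t)
          continuous_toFun := by fun_prop
          source' := f.2 (a, 0) (.inr (.inl rfl))
          target' := f.2 (a, 1) (.inr (.inr rfl)) }, by
        refine Path.continuous_uncurry_iff.1 ?_
        exact f.1.continuous⟩, by
        rintro _ rfl
        exact Path.ext (funext fun t => f.2 (_, t) (.inl rfl))⟩) (by
      rintro f g ⟨H⟩
      refine ⟨{ toFun := fun z =>
                  { toFun := fun t => H (z.1, (z.2, t))
                    continuous_toFun := by fun_prop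
                    source' := (H.eq_fst z.1 (.inr (.inl rfl))).trans
                      (f.2 (z.2, 0) (.inr (.inl rfl)))
                    target' := (H.eq_fst z.1 (.inr (.inr rfl))).trans
                      (f.2 (z.2, 1) (.inr (.inr rfl))) }
                continuous_toFun := by
                  refine Path.continuous_uncurry_iff.1 ?_
                  change Continuous fun w : (I × X) × I => H (w.1.1, (w.1.2, w.2))
                  fun_prop
                map_zero_left := fun a => Path.ext (funext fun t => H.apply_zero (a, t))
                map_one_left := fun a => Path.ext (funext fun t => H.apply_one (a, t))
                prop' := ?_ }⟩
      rintro r _ rfl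
      exact Path.ext (funext fun t => H.eq_fst r (.inl rfl)))
  left_inv := by
    rintro ⟨f⟩
    exact congrArg (Quotient.mk (relSetoid X {x} (LoopSpace Y y) (Path.refl y)))
      (Subtype.ext (ContinuousMap.ext fun _ => rfl))
  right_inv := by
    rintro ⟨f⟩
    exact congrArg (Quotient.mk (relSetoid (X × I) {z | z.1 = x ∨ z.2 = 0 ∨ z.2 = 1} Y y))
      (Subtype.ext (ContinuousMap.ext fun _ => rfl))

/-- The adjunction bijection `[X, ΩY] ≅ [ΣX, Y]`. -/
def loopAdj {X Y : Type*} [TopologicalSpace X] [TopologicalSpace Y] (x : X) (y : Y) :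
    PtdClasses X x (LoopSpace Y y) (Path.refl y) ≃ PtdClasses (Susp X x) (Susp.base x) Y y :=
  (curryEquiv x y).trans ((Susp.isCollapse x).equiv y)

/-! ### Tori -/

/-- The torus `𝕋ᵏ`, with base point `0`. -/
abbrev Torus (k : ℕ) : Type := Fin k → UnitAddCircle

/-- The `d`-skeleton of `𝕋ᵏ`: at most `d` coordinates differ from the base point. -/
def torusSkeleton (k d : ℕ) : Set (Torus k) := {t | {i | t i ≠ 0}.ncard ≤ d}

/-- The quotient `𝕋ᵏ / (𝕋ᵏ)⁽ᵏ⁻¹⁾` of the torus by its codimension one skeleton; for `k ≥ 1`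
this is a `k`-sphere. -/
abbrev TorusTop (k : ℕ) : Type := Collapse (torusSkeleton k (k - 1))

/-- The quotient projection `𝕋ᵏ → 𝕋ᵏ / (𝕋ᵏ)⁽ᵏ⁻¹⁾`. -/
def torusTopProj (k : ℕ) : C(Torus k, TorusTop k) := Collapse.proj _

/-- The base point of `𝕋ᵏ / (𝕋ᵏ)⁽ᵏ⁻¹⁾`. -/
def TorusTop.base (k : ℕ) : TorusTop k := torusTopProj k 0

/-- The quotient map `[0,1]ᵏ → 𝕋ᵏ → 𝕋ᵏ / (𝕋ᵏ)⁽ᵏ⁻¹⁾`. -/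
def cubeToTorusTop (k : ℕ) : C(Fin k → I, TorusTop k) :=
  (torusTopProj k).comp ⟨fun u i => circleParam (u i), by fun_prop⟩

theorem mem_torusSkeleton_iff (m : ℕ) (u : Fin (m + 1) → I) :
    (fun i => circleParam (u i)) ∈ torusSkeleton (m + 1) (m + 1 - 1) ↔
      u ∈ Cube.boundary (Fin (m + 1)) := by
  have h1 : u ∈ Cube.boundary (Fin (m + 1)) ↔ ∃ i, circleParam (u i) = 0 := by
    simp only [Cube.boundary, Set.mem_ofPred_eq, circleParam_eq_zero]
  rw [h1]
  simp only [torusSkeleton, Set.mem_ofPred_eq, Nat.add_sub_cancel]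
  constructor
  · intro h
    by_contra! k
    have : {i | circleParam (u i) ≠ 0} = Set.univ := Set.eq_univ_of_forall k
    rw [this, Set.ncard_univ, Nat.card_fin] at h
    omega
  · rintro ⟨i, hi⟩
    have : {i | circleParam (u i) ≠ 0} ⊂ Set.univ :=
      Set.ssubset_univ_iff.2 fun e => (e.symm ▸ Set.mem_univ i : i ∈ {i | circleParam (u i) ≠ 0}) hi
    have := Set.ncard_lt_ncard this
    rw [Set.ncard_univ, Nat.card_fin] at this
    omega

theorem cubeToTorusTop_isCollapse (m : ℕ) :
    IsCollapse (cubeToTorusTop (m + 1)) (Cube.boundary (Fin (m + 1))) (TorusTop.base (m + 1)) where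
  isQuotientMap := by
    have hc : Continuous fun (u : Fin (m + 1) → I) i => circleParam (u i) := by fun_prop
    have h : IsQuotientMap fun (u : Fin (m + 1) → I) i => circleParam (u i) :=
      hc.isClosedMap.isQuotientMap hc fun t =>
        ⟨fun i => (circleParam_surjective (t i)).choose,
          funext fun i => (circleParam_surjective (t i)).choose_spec⟩
    exact (isQuotientMap_quot_mk : IsQuotientMap (torusTopProj (m + 1))).comp h
  nonempty := ⟨0, 0, .inl rfl⟩
  map_eq := by
    intro u hu
    refine Collapse.proj_eq_iff.2 (.inr ⟨(mem_torusSkeleton_iff m u).2 hu, ?_⟩)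
    simp [torusSkeleton]
  inj := by
    intro u v h
    rcases Collapse.proj_eq_iff.1 h with h | ⟨h, k⟩
    · by_cases e : u = v
      · exact .inl e
      · obtain ⟨i, hi⟩ := Function.ne_iff.1 e
        obtain ⟨k, k'⟩ := (circleParam_inj (congrFun h i)).resolve_left hi
        exact .inr ⟨⟨i, k⟩, ⟨i, k'⟩⟩
    · exact .inr ⟨(mem_torusSkeleton_iff m u).1 h, (mem_torusSkeleton_iff m v).1 k⟩

/-- The identification `π_k(Y) ≅ [𝕋ᵏ / (𝕋ᵏ)⁽ᵏ⁻¹⁾, Y]`, `k = m + 1`, that comes from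
`[0,1]ᵏ / ∂[0,1]ᵏ ≅ 𝕋ᵏ / (𝕋ᵏ)⁽ᵏ⁻¹⁾ ≅ Sᵏ`. -/
def piEquiv (m : ℕ) {Y : Type*} [TopologicalSpace Y] (y : Y) :
    HomotopyGroup (Fin (m + 1)) Y y ≃
      PtdClasses (TorusTop (m + 1)) (TorusTop.base (m + 1)) Y y :=
  (Quotient.congr (Equiv.refl _) (fun _ _ => Iff.rfl) :
      HomotopyGroup (Fin (m + 1)) Y y ≃
        RelClasses (Fin (m + 1) → I) (Cube.boundary (Fin (m + 1))) Y y).trans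
    ((cubeToTorusTop_isCollapse m).equiv y)

/-- The map `p : 𝕋ᵐ⁺¹ → 𝕋ᵐ⁺¹ / (A₀ ∨ S) = Σ𝕋ᵐ`, where `A₀ = 𝕋ᵐ × {0}` and `S = {0} × S¹`. -/
def torusToSusp (m : ℕ) : C(Torus (m + 1), Susp (Torus m) 0) :=
  (Susp.proj 0).comp ⟨fun t => (fun i => t i.castSucc, t (Fin.last m)), by fun_prop⟩

/-! ### Configuration spaces and the maps between sets of homotopy classes -/

/-- The configuration space of `n` distinct points in `ℝ³`. -/
abbrev Conf (n : ℕ) : Type :=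
  {x : Fin n → EuclideanSpace ℝ (Fin 3) // ∀ i j, i ≠ j → x i ≠ x j}

/-- The torus homotopy group (as a set) `T(n) = [𝕋ⁿ⁻¹, ΩConf(n)]`, with `n = m + 1`. -/
abbrev TorusGroup (m : ℕ) (q : Conf (m + 1)) : Type :=
  PtdClasses (Torus m) 0 (LoopSpace (Conf (m + 1)) q) (Path.refl q)

/-- `π_N(ΩConf(n)) = [S^N, ΩConf(n)]`, with `n = m + 1`, for the top multi-index
`N = (1, …, n - 1)`; here `S^N = 𝕋ⁿ⁻¹ / (𝕋ⁿ⁻¹)⁽ⁿ⁻²⁾`. -/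
abbrev PiTop (m : ℕ) (q : Conf (m + 1)) : Type :=
  PtdClasses (TorusTop m) (TorusTop.base m) (LoopSpace (Conf (m + 1)) q) (Path.refl q)

/-- `j_N^# : π_N(ΩConf(n)) → T(n)`. -/
def jTop (m : ℕ) (q : Conf (m + 1)) : PiTop m q → TorusGroup m q :=
  precomp (torusTopProj m) rfl

/-- `p^# : T(n) = [Σ𝕋ⁿ⁻¹, Conf(n)] → [𝕋ⁿ, Conf(n)]`. -/
def pSharp (m : ℕ) (q : Conf (m + 1)) :
    TorusGroup m q → PtdClasses (Torus (m + 1)) 0 (Conf (m + 1)) q :=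
  fun a => precomp (torusToSusp m) rfl (loopAdj 0 q a)

/-- `q^# : π_n(Conf(n)) ≅ [𝕋ⁿ / (𝕋ⁿ)⁽ⁿ⁻¹⁾, Conf(n)] → [𝕋ⁿ, Conf(n)]`, with `n = m + 1`,
induced by the collapse map. -/
def collapseSharp (m : ℕ) (q : Conf (m + 1)) :
    HomotopyGroup (Fin (m + 1)) (Conf (m + 1)) q →
      PtdClasses (Torus (m + 1)) 0 (Conf (m + 1)) q :=
  fun a => precomp (torusTopProj (m + 1)) rfl (piEquiv m q a)

end

/-! For every pointed space `Y` the collapse induces an injection from π_n(Y) to [𝕋ⁿ, Y];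
configuration spaces matter only when n = 1. Two facts combine.

The kernel is trivial. A null-homotopy on 𝕋ⁿ of a map that is constant on all faces `t i = 0` can be
corrected one face at a time (`exists_nullHomotopy_const_on_face`) until it is relative to the
boundary of the cube. The correction spreads the homotopy over a disk whose centre is the initial
constant map, so it does not apply directly to a homotopy between two arbitrary maps.

The pinch 𝕋ⁿ → 𝕋ⁿ ∨ Sⁿ makes π_n(Y) act on pointed maps of 𝕋ⁿ, and on classes from π_n this action
is multiplication (`cornerGlue`, `HomotopyGroup.mk_cornerGlue`). If f and g are homotopic on the
torus, glue γ with [γ] = [f]⁻¹ into a corner of both: f with γ is null, hence so is g with γ on the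
torus, hence [γ][g] = 1 = [γ][f].

Finally p^# ∘ j_N^# is q^# up to a bijection, by the exponential law and by writing the suspended
sphere as a cube modulo its boundary. -/

noncomputable section

/-! ### Making null-homotopies on the torus constant on its faces -/

/-- Polar coordinates `I × S¹ → D²` on the closed unit disk. -/
def polarDisk : C(I × UnitAddCircle, Metric.closedBall (0 : ℂ) 1) :=
  ⟨fun z => ⟨((z.1 : ℝ) : ℂ) * (AddCircle.toCircle z.2 : ℂ), by
      simpa [Circle.norm_coe, abs_of_nonneg z.1.2.1] using z.1.2.2⟩, by
    have h : Continuous fun z : I × UnitAddCircle => AddCircle.toCircle z.2 :=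
      AddCircle.continuous_toCircle.comp continuous_snd
    fun_prop⟩

theorem polarDisk_surjective : Function.Surjective polarDisk := by
  rintro ⟨z, hz⟩
  have hz' : ‖z‖ ≤ 1 := by simpa using hz
  by_cases h : z = 0
  · exact ⟨(0, 0), Subtype.ext (by simp [polarDisk, h])⟩
  · have hn : ‖z‖ ≠ 0 := norm_ne_zero_iff.2 h
    have hc : z / ‖z‖ ∈ Submonoid.unitSphere ℂ := by
      simp [Submonoid.unitSphere, hn]
    obtain ⟨θ, hθ⟩ := (AddCircle.homeomorphCircle (T := (1 : ℝ)) one_ne_zero).surjective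
      (⟨z / ‖z‖, hc⟩ : Circle)
    rw [AddCircle.homeomorphCircle_apply] at hθ
    refine ⟨(⟨‖z‖, norm_nonneg z, hz'⟩, θ), Subtype.ext ?_⟩
    have : (‖z‖ : ℂ) ≠ 0 := by exact_mod_cast hn
    simp only [polarDisk, ContinuousMap.coe_mk, hθ]
    exact mul_div_cancel₀ z this

theorem polarDisk_inj {s s' : I} {θ θ' : UnitAddCircle}
    (h : polarDisk (s, θ) = polarDisk (s', θ')) : s = s' ∧ (s = 0 ∨ θ = θ') := by
  have h' : ((s : ℝ) : ℂ) * (AddCircle.toCircle θ : ℂ) =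
      ((s' : ℝ) : ℂ) * (AddCircle.toCircle θ' : ℂ) := congrArg Subtype.val h
  have hs : s = s' := by
    have := congrArg norm h'
    simp only [norm_mul, Circle.norm_coe, mul_one, Complex.norm_real, Real.norm_eq_abs,
      abs_of_nonneg s.2.1, abs_of_nonneg s'.2.1] at this
    exact Subtype.ext this
  subst hs
  refine ⟨rfl, or_iff_not_imp_left.2 fun h0 => ?_⟩
  have h0' : ((s : ℝ) : ℂ) ≠ 0 := by
    simpa [Complex.ofReal_eq_zero] using h0
  exact AddCircle.injective_toCircle one_ne_zero (Circle.ext (mul_left_cancel₀ h0' h'))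

/-- The segment in the unit disk from `1` to the boundary point with angle `θ`. -/
def diskChord : C(I × UnitAddCircle, Metric.closedBall (0 : ℂ) 1) :=
  ⟨fun z => ⟨((1 - (z.1 : ℝ) : ℝ) : ℂ) + ((z.1 : ℝ) : ℂ) * (AddCircle.toCircle z.2 : ℂ), by
      have h := norm_add_le ((1 - (z.1 : ℝ) : ℝ) : ℂ)
        (((z.1 : ℝ) : ℂ) * (AddCircle.toCircle z.2 : ℂ))
      simp only [norm_mul, Circle.norm_coe, mul_one, Complex.norm_real, Real.norm_eq_abs,
        abs_of_nonneg z.1.2.1, abs_of_nonneg (sub_nonneg.2 z.1.2.2), sub_add_cancel] at h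
      simpa using h⟩, by
    have h : Continuous fun z : I × UnitAddCircle => AddCircle.toCircle z.2 :=
      AddCircle.continuous_toCircle.comp continuous_snd
    fun_prop⟩

theorem diskChord_zero_left (θ : UnitAddCircle) : diskChord (0, θ) = polarDisk (1, 0) :=
  Subtype.ext (by simp [diskChord, polarDisk])

theorem diskChord_one_left (θ : UnitAddCircle) : diskChord (1, θ) = polarDisk (1, θ) :=
  Subtype.ext (by simp [diskChord, polarDisk])

theorem diskChord_zero_right (s : I) : diskChord (s, 0) = polarDisk (1, 0) :=
  Subtype.ext (by simp [diskChord, polarDisk])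

/-- A null-homotopy of maps on the torus whose end map is constant on the face `t i = 0` can be
made constant on this face, without losing constancy on any other face. -/
theorem exists_nullHomotopy_const_on_face {n : ℕ} {Y : Type*} [TopologicalSpace Y] {y : Y}
    (K : C(I × Torus n, Y)) (h0 : ∀ t, K (0, t) = y) (i : Fin n)
    (h1 : ∀ t : Torus n, t i = 0 → K (1, t) = y) :
    ∃ K' : C(I × Torus n, Y), (∀ t, K' (0, t) = y) ∧ (∀ t, K' (1, t) = K (1, t)) ∧
      (∀ s (t : Torus n), t i = 0 → K' (s, t) = y) ∧
      ∀ j, (∀ s (t : Torus n), t j = 0 → K (s, t) = y) →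
        ∀ s (t : Torus n), t j = 0 → K' (s, t) = y := by
  -- Time becomes the radius and the i-th coordinate the angle. The map descends to the disk because
  -- `K` is constant at time 0, the centre.
  let π : C((I × UnitAddCircle) × Torus n, Metric.closedBall (0 : ℂ) 1 × Torus n) :=
    polarDisk.prodMap (ContinuousMap.id _)
  have hπ : IsQuotientMap π := π.continuous.isClosedMap.isQuotientMap π.continuous
    (polarDisk_surjective.prodMap Function.surjective_id)
  let K₂ : C((I × UnitAddCircle) × Torus n, Y) :=
    ⟨fun z => K (z.1.1, Function.update z.2 i z.1.2), by fun_prop⟩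
  have hf : Function.FactorsThrough K₂ π := by
    rintro ⟨⟨s, θ⟩, w⟩ ⟨⟨s', θ'⟩, w'⟩ h
    obtain ⟨h, rfl : w = w'⟩ := Prod.ext_iff.1 h
    obtain ⟨rfl, rfl | rfl⟩ := polarDisk_inj h
    · exact (h0 _).trans (h0 _).symm
    · rfl
  have hL : ∀ s θ w, hπ.lift K₂ hf (polarDisk (s, θ), w) = K (s, Function.update w i θ) :=
    fun s θ w => DFunLike.congr_fun (hπ.lift_comp K₂ hf) ((s, θ), w)
  -- The new homotopy runs along the chord from 1 to the boundary point with angle `t i`. It starts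
  -- at 1, where the value is `y` by `h1`, and the chord is stationary when `t i = 0`.
  refine ⟨(hπ.lift K₂ hf).comp ⟨fun z => (diskChord (z.1, z.2 i), z.2), by fun_prop⟩,
    fun t => ?_, fun t => ?_, fun s t ht => ?_, fun j hj s t ht => ?_⟩ <;>
    simp only [ContinuousMap.comp_apply, ContinuousMap.coe_mk]
  · rw [diskChord_zero_left, hL]
    exact h1 _ (by simp)
  · rw [diskChord_one_left, hL, Function.update_eq_self]
  · rw [ht, diskChord_zero_right, hL]
    exact h1 _ (by simp)
  -- Each new value is a value of `K` with only the i-th coordinate altered, so constancy on another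
  -- face persists; for `j = i` the chord stays at 1.
  · obtain ⟨⟨r, θ⟩, h⟩ := polarDisk_surjective (diskChord (s, t i))
    rw [← h, hL]
    by_cases e : j = i
    · subst e
      have hz : polarDisk (r, θ) = polarDisk (1, 0) := by
        rw [h, ht, diskChord_zero_right]
      obtain ⟨rfl, h' | rfl⟩ := polarDisk_inj hz
      · exact absurd h' one_ne_zero
      · exact hj _ _ (by simp)
    · exact hj _ _ (by rw [Function.update_of_ne e]; exact ht)

/-- Faces can be treated in turn, since a correction never spoils a face already corrected. -/
theorem exists_nullHomotopy_const_on_faces {n : ℕ} {Y : Type*} [TopologicalSpace Y] {y : Y}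
    (K : C(I × Torus n, Y)) (h0 : ∀ t, K (0, t) = y)
    (h1 : ∀ (t : Torus n) i, t i = 0 → K (1, t) = y) (J : Finset (Fin n)) :
    ∃ K' : C(I × Torus n, Y), (∀ t, K' (0, t) = y) ∧ (∀ t, K' (1, t) = K (1, t)) ∧
      ∀ i ∈ J, ∀ s (t : Torus n), t i = 0 → K' (s, t) = y := by
  induction J using Finset.induction_on with
  | empty => exact ⟨K, h0, fun _ => rfl, by simp⟩
  | insert i J _ ih =>
    obtain ⟨L, hL0, hL1, hLJ⟩ := ih
    obtain ⟨L', h0', h1', hi', hJ'⟩ := exists_nullHomotopy_const_on_face L hL0 i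
      fun t ht => (hL1 t).trans (h1 t i ht)
    refine ⟨L', h0', fun t => (h1' t).trans (hL1 t), fun j hj => ?_⟩
    rcases Finset.mem_insert.1 hj with rfl | hj
    exacts [hi', hJ' j (hLJ j hj)]

/-! ### From torus homotopies to homotopies relative to the boundary of the cube -/

/-- The parametrization of the torus by the cube. -/
def torusParam (n : ℕ) : C(Fin n → I, Torus n) := ⟨fun u i => circleParam (u i), by fun_prop⟩

theorem torusParam_surjective (n : ℕ) : Function.Surjective (torusParam n) := fun t =>
  ⟨fun i => (circleParam_surjective (t i)).choose,
    funext fun i => (circleParam_surjective (t i)).choose_spec⟩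

/-- A map of `([0,1]ⁿ, ∂[0,1]ⁿ)` that is null-homotopic through maps factoring through the torus is
null-homotopic relative to the boundary. -/
theorem homotopicRel_const_of_homotopicWith_factorsThrough {n : ℕ} {Y : Type*} [TopologicalSpace Y]
    {y : Y} {k : C(Fin n → I, Y)} (hk : ∀ u ∈ Cube.boundary (Fin n), k u = y)
    (h : (ContinuousMap.const _ y).HomotopicWith k
      fun φ => Function.FactorsThrough φ (torusParam n)) :
    (ContinuousMap.const _ y).HomotopicRel k (Cube.boundary (Fin n)) := by
  obtain ⟨H⟩ := h
  let π : C(I × (Fin n → I), I × Torus n) := (ContinuousMap.id _).prodMap (torusParam n)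
  have hπ : IsQuotientMap π := π.continuous.isClosedMap.isQuotientMap π.continuous
    (Function.surjective_id.prodMap (torusParam_surjective n))
  have hf : Function.FactorsThrough (H.toContinuousMap : I × (Fin n → I) → Y) π := by
    rintro ⟨s, u⟩ ⟨s', u'⟩ h
    obtain ⟨rfl : s = s', h⟩ := Prod.ext_iff.1 h
    exact H.prop' s h
  have hL : ∀ s u, hπ.lift H.toContinuousMap hf (s, torusParam n u) = H (s, u) :=
    fun s u => DFunLike.congr_fun (hπ.lift_comp H.toContinuousMap hf) (s, u)
  -- Intermediate maps of `H` need not be pointed; correcting every face restores this.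
  obtain ⟨K, hK0, hK1, hK⟩ := exists_nullHomotopy_const_on_faces (y := y)
    (hπ.lift H.toContinuousMap hf)
    (fun t => by
      obtain ⟨u, rfl⟩ := torusParam_surjective n t
      rw [hL, H.apply_zero]; rfl)
    (fun t i ht => by
      obtain ⟨u, rfl⟩ := torusParam_surjective n t
      rw [hL, H.apply_one]
      exact hk u ⟨i, circleParam_eq_zero.1 ht⟩) Finset.univ
  exact ⟨{ toFun := fun z => K (z.1, torusParam n z.2)
           continuous_toFun := by fun_prop
           map_zero_left := fun u => hK0 _
           map_one_left := fun u => by rw [hK1, hL, H.apply_one]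
           prop' := fun s u ⟨i, hi⟩ =>
            hK i (Finset.mem_univ i) s (torusParam n u) (circleParam_eq_zero.2 hi) }⟩

/-! ### Gluing a sphere into a corner of the cube -/

/-- The map `t ↦ min (2t) 1` of the unit interval. -/
def runFirst : C(I, I) := ⟨fun t => Set.projIcc 0 1 zero_le_one (2 * t), by fun_prop⟩

/-- The map `t ↦ max (2t - 1) 0` of the unit interval. -/
def runSecond : C(I, I) := ⟨fun t => Set.projIcc 0 1 zero_le_one (2 * t - 1), by fun_prop⟩

theorem runFirst_zero : runFirst 0 = 0 := by
  simp [runFirst]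

theorem runFirst_of_half_le {t : I} (h : (1 / 2 : ℝ) ≤ t) : runFirst t = 1 :=
  Set.projIcc_of_right_le zero_le_one (by linarith)

theorem runSecond_of_le_half {t : I} (h : (t : ℝ) ≤ 1 / 2) : runSecond t = 0 :=
  Set.projIcc_of_le_left zero_le_one (by linarith)

theorem runFirst_one : runFirst 1 = 1 := runFirst_of_half_le (by norm_num)

theorem runSecond_zero : runSecond 0 = 0 := runSecond_of_le_half (by norm_num)

theorem runSecond_one : runSecond 1 = 1 :=
  Set.projIcc_of_right_le zero_le_one (by norm_num)

/-- The map of the cube `[0,1]ᵐ⁺¹` equal to a rescaled copy of `γ` on the subcube `[1/2,1]ᵐ⁺¹`, and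
to `F ∘ min (2 u) 1` elsewhere. -/
def cornerGlue {m : ℕ} {Y : Type*} (F γ : (Fin (m + 1) → I) → Y) (u : Fin (m + 1) → I) : Y :=
  open Classical in
  if ∃ i, (u i : ℝ) ≤ 1 / 2 then F (fun i => runFirst (u i)) else γ (fun i => runSecond (u i))

/-- On the interface the smallest coordinate is 1/2: every `runFirst` is 1 and some `runSecond` is
0, so both branches give `y`. The factor `X` carries a homotopy parameter. -/
theorem continuous_cornerGlue {m : ℕ} {X Y : Type*} [TopologicalSpace X] [TopologicalSpace Y]
    {y : Y} {F : X × (Fin (m + 1) → I) → Y} (hF : Continuous F) (hF1 : ∀ x, F (x, 1) = y)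
    (γ : GenLoop (Fin (m + 1)) Y y) :
    Continuous fun z : X × (Fin (m + 1) → I) => cornerGlue (fun u => F (z.1, u)) γ z.2 := by
  have hm : Continuous fun z : X × (Fin (m + 1) → I) =>
      Finset.univ.inf' Finset.univ_nonempty fun i => (z.2 i : ℝ) :=
    Continuous.finset_inf'_apply _ fun i _ => by fun_prop
  have he : ∀ z : X × (Fin (m + 1) → I), (∃ i, (z.2 i : ℝ) ≤ 1 / 2) ↔
      (Finset.univ.inf' Finset.univ_nonempty fun i => (z.2 i : ℝ)) ≤ 1 / 2 := fun z => by
    simp [Finset.inf'_le_iff]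
  simp only [cornerGlue, he]
  refine Continuous.if_le ?_ ?_ hm continuous_const fun z hz => ?_
  · exact hF.comp (by fun_prop)
  · exact γ.1.continuous.comp (by fun_prop)
  · have h1 : ∀ i, (1 / 2 : ℝ) ≤ z.2 i := fun i => by
      rw [← hz]; exact Finset.inf'_le _ (Finset.mem_univ i)
    obtain ⟨i, hi⟩ := (he z).2 hz.le
    have : (fun i => runFirst (z.2 i)) = 1 := funext fun i => runFirst_of_half_le (h1 i)
    rw [this, hF1]
    exact (γ.2 _ ⟨i, .inl (runSecond_of_le_half hi)⟩).symm

/-- Distinct cube points with the same torus image lie on the boundary. There the glued map is `F`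
after `runFirst`, which respects the torus identifications because `runFirst` fixes 0 and 1. -/
theorem cornerGlue_factorsThrough {m : ℕ} {Y : Type*} [TopologicalSpace Y] {y : Y}
    {F : (Fin (m + 1) → I) → Y} (hF : Function.FactorsThrough F (torusParam (m + 1)))
    (hF1 : F 1 = y) (γ : GenLoop (Fin (m + 1)) Y y) :
    Function.FactorsThrough (cornerGlue F γ) (torusParam (m + 1)) := by
  have key : ∀ u : Fin (m + 1) → I, u ∈ Cube.boundary _ →
      cornerGlue F γ u = F (fun i => runFirst (u i)) := by
    intro u hu
    by_cases h : ∃ i, (u i : ℝ) ≤ 1 / 2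
    · exact if_pos h
    · refine (if_neg h).trans ?_
      push Not at h
      have : (fun i => runFirst (u i)) = 1 := funext fun i => runFirst_of_half_le (h i).le
      rw [this, hF1]
      obtain ⟨i, hi⟩ := hu
      refine γ.2 _ ⟨i, ?_⟩
      rcases hi with hi | hi <;> simp [hi, runSecond_zero, runSecond_one]
  intro u v h
  by_cases huv : u = v
  · rw [huv]
  · obtain ⟨i, hi⟩ := Function.ne_iff.1 huv
    obtain ⟨hu, hv⟩ := (circleParam_inj (congrFun h i)).resolve_left hi
    rw [key u ⟨i, hu⟩, key v ⟨i, hv⟩]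
    refine hF (funext fun j => ?_)
    change circleParam (runFirst (u j)) = circleParam (runFirst (v j))
    have hz : ∀ t : I, t = 0 ∨ t = 1 → circleParam (runFirst t) = 0 := by
      rintro t (rfl | rfl)
      · rw [runFirst_zero, circleParam_zero]
      · rw [runFirst_one, circleParam_one]
    rcases circleParam_inj (congrFun h j) with e | ⟨e, e'⟩
    · rw [e]
    · rw [hz _ e, hz _ e']

/-! ### Corner gluing is multiplication in the homotopy group -/

/-- Reparametrizing the coordinates of the cube by self-maps of `[0,1]` that fix the end points does
not change the class of a map of `([0,1]ⁿ, ∂[0,1]ⁿ)`. -/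
theorem GenLoop.homotopic_of_eq_reparam {n : ℕ} {Y : Type*} [TopologicalSpace Y] {y : Y}
    (f g : GenLoop (Fin n) Y y) (φ : Fin n → C(I, I)) (h0 : ∀ i, φ i 0 = 0) (h1 : ∀ i, φ i 1 = 1)
    (hg : ∀ u, g u = f fun i => φ i (u i)) : GenLoop.Homotopic f g := by
  let ℓ : I × I × I → I := fun z =>
    Set.projIcc 0 1 zero_le_one ((1 - (z.1 : ℝ)) * z.2.1 + z.1 * z.2.2)
  have hℓ : Continuous ℓ := by fun_prop
  have ℓ0 : ∀ a b, ℓ (0, a, b) = a := fun a b => by simp [ℓ]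
  have ℓ1 : ∀ a b, ℓ (1, a, b) = b := fun a b => by simp [ℓ]
  have ℓ00 : ∀ s, ℓ (s, 0, 0) = 0 := fun s => by simp [ℓ]
  have ℓ11 : ∀ s, ℓ (s, 1, 1) = 1 := fun s => by simp [ℓ]
  exact ⟨{ toFun := fun z => f fun i => ℓ (z.1, z.2 i, φ i (z.2 i))
           continuous_toFun := f.1.continuous.comp (by fun_prop)
           map_zero_left := fun u => by simp [ℓ0]
           map_one_left := fun u => by simp only [ℓ1]; exact (hg u).symm
           prop' := by
            rintro s u ⟨i, hi⟩
            refine (f.2 _ ⟨i, ?_⟩).trans (f.2 u ⟨i, hi⟩).symm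
            rcases hi with hi | hi <;> simp only [hi, h0, h1, ℓ00, ℓ11, true_or, or_true] }⟩

/-- `cornerGlue` as an operation on maps of `([0,1]ᵐ⁺¹, ∂[0,1]ᵐ⁺¹)`. -/
def GenLoop.cornerGlue {m : ℕ} {Y : Type*} [TopologicalSpace Y] {y : Y}
    (f γ : GenLoop (Fin (m + 1)) Y y) : GenLoop (Fin (m + 1)) Y y :=
  ⟨⟨_root_.cornerGlue f γ, (continuous_cornerGlue (X := Unit) (F := fun z => f z.2)
      (f.1.continuous.comp continuous_snd) (fun _ => f.2 _ ⟨0, .inr rfl⟩) γ).comp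
      (Continuous.prodMk_right ())⟩, by
    rintro u ⟨i, hi⟩
    change _root_.cornerGlue f γ u = y
    unfold _root_.cornerGlue
    split_ifs
    · refine f.2 _ ⟨i, ?_⟩
      rcases hi with hi | hi <;> simp [hi, runFirst_zero, runFirst_one]
    · refine γ.2 _ ⟨i, ?_⟩
      rcases hi with hi | hi <;> simp [hi, runSecond_zero, runSecond_one]⟩

theorem GenLoop.cornerGlue_apply {m : ℕ} {Y : Type*} [TopologicalSpace Y] {y : Y}
    (f γ : GenLoop (Fin (m + 1)) Y y) (u : Fin (m + 1) → I) :
    GenLoop.cornerGlue f γ u = _root_.cornerGlue f γ u := rfl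

/-- Precomposition with a self-map of each coordinate interval fixing the end points. -/
def GenLoop.reparam {n : ℕ} {Y : Type*} [TopologicalSpace Y] {y : Y} (f : GenLoop (Fin n) Y y)
    (φ : Fin n → C(I, I)) (h0 : ∀ i, φ i 0 = 0) (h1 : ∀ i, φ i 1 = 1) : GenLoop (Fin n) Y y :=
  ⟨⟨fun u => f fun i => φ i (u i), f.1.continuous.comp (by fun_prop)⟩, by
    rintro u ⟨i, hi⟩
    refine f.2 _ ⟨i, ?_⟩
    rcases hi with hi | hi <;> simp [hi, h0, h1]⟩

/-- The class of a map of `([0,1]ⁿ, ∂[0,1]ⁿ)`. -/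
def HomotopyGroup.mk {N Y : Type*} [TopologicalSpace Y] {y : Y} (f : GenLoop N Y y) :
    HomotopyGroup N Y y :=
  Quotient.mk _ f

/-- The class of a corner gluing is the product in the homotopy group. -/
theorem HomotopyGroup.mk_cornerGlue {m : ℕ} {Y : Type*} [TopologicalSpace Y] {y : Y}
    (f γ : GenLoop (Fin (m + 1)) Y y) :
    mk (GenLoop.cornerGlue f γ) = mk γ * mk f := by
  -- Coordinate 0 is left alone because concatenation in that direction already applies `runFirst`
  -- or `runSecond` there. With the other coordinates reparametrized beforehand, concatenation
  -- equals the corner gluing on the nose.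
  let φ : C(I, I) → Fin (m + 1) → C(I, I) := fun c => Function.update (fun _ => c) 0 (.id I)
  have h0 : ∀ c : C(I, I), c 0 = 0 → ∀ i, φ c i 0 = 0 := fun c hc i => by
    by_cases h : i = 0 <;> simp [φ, h, hc]
  have h1 : ∀ c : C(I, I), c 1 = 1 → ∀ i, φ c i 1 = 1 := fun c hc i => by
    by_cases h : i = 0 <;> simp [φ, h, hc]
  let f' := GenLoop.reparam f (φ runFirst) (h0 _ runFirst_zero) (h1 _ runFirst_one)
  let γ' := GenLoop.reparam γ (φ runSecond) (h0 _ runSecond_zero) (h1 _ runSecond_one)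
  have hf : mk f = mk f' :=
    Quotient.sound (GenLoop.homotopic_of_eq_reparam f f' _ (h0 _ runFirst_zero)
      (h1 _ runFirst_one) fun _ => rfl)
  have hγ : mk γ = mk γ' :=
    Quotient.sound (GenLoop.homotopic_of_eq_reparam γ γ' _ (h0 _ runSecond_zero)
      (h1 _ runSecond_one) fun _ => rfl)
  rw [hf, hγ]
  -- In `HomotopyGroup.mul_spec` the right factor is run first, hence the order of `γ` and `f`.
  refine Eq.trans ?_ (HomotopyGroup.mul_spec (i := 0) (p := γ') (q := f')).symm
  refine congrArg (Quotient.mk _) (GenLoop.ext _ _ fun u => ?_)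
  have e1 : (fun i => φ runFirst i (Function.update u 0 (runFirst (u 0)) i)) =
      fun i => runFirst (u i) := funext fun i => by
    by_cases h : i = 0
    · subst h; simp [φ]
    · simp [φ, h]
  have e2 : (fun i => φ runSecond i (Function.update u 0 (runSecond (u 0)) i)) =
      fun i => runSecond (u i) := funext fun i => by
    by_cases h : i = 0
    · subst h; simp [φ]
    · simp [φ, h]
  have hR : GenLoop.transAt 0 f' γ' u = if (u 0 : ℝ) ≤ 1 / 2 then f (fun i => runFirst (u i))
      else γ (fun i => runSecond (u i)) := by
    rw [← e1, ← e2]; rfl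
  rw [hR, GenLoop.cornerGlue_apply, cornerGlue]
  by_cases h : (u 0 : ℝ) ≤ 1 / 2
  · rw [if_pos ⟨0, h⟩, if_pos h]
  · rw [if_neg h]
    split_ifs with h'
    -- The only region where the branches differ: `u 0 > 1/2` but another coordinate is at most 1/2.
    -- Both sides equal `y`.
    · obtain ⟨i, hi⟩ := h'
      exact (f.2 (fun i => runFirst (u i)) ⟨0, .inr (runFirst_of_half_le (not_le.1 h).le)⟩).trans
        (γ.2 (fun i => runSecond (u i)) ⟨i, .inl (runSecond_of_le_half hi)⟩).symm
    · rfl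

/-! ### Injectivity for an arbitrary pointed space -/

theorem torusParam_zero (n : ℕ) : torusParam n 0 = 0 := funext fun _ => circleParam_zero

theorem torusParam_one (n : ℕ) : torusParam n 1 = 0 := funext fun _ => circleParam_one

theorem GenLoop.factorsThrough_torusParam {n : ℕ} {Y : Type*} [TopologicalSpace Y] {y : Y}
    (f : GenLoop (Fin n) Y y) : Function.FactorsThrough f (torusParam n) := by
  intro u v h
  by_cases huv : u = v
  · rw [huv]
  · obtain ⟨i, hi⟩ := Function.ne_iff.1 huv
    obtain ⟨hu, hv⟩ := (circleParam_inj (congrFun h i)).resolve_left hi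
    exact (f.2 u ⟨i, hu⟩).trans (f.2 v ⟨i, hv⟩).symm

/-- Two maps of `([0,1]ᵏ, ∂[0,1]ᵏ)` that are homotopic as pointed maps of the torus represent the
same element of the homotopy group. -/
theorem HomotopyGroup.mk_eq_of_torus_homotopicRel {m : ℕ} {Y : Type*} [TopologicalSpace Y] {y : Y}
    (f g : GenLoop (Fin (m + 1)) Y y) (f' g' : C(Torus (m + 1), Y))
    (hf : ∀ u, f' (torusParam _ u) = f u) (hg : ∀ u, g' (torusParam _ u) = g u)
    (h : f'.HomotopicRel g' {0}) : HomotopyGroup.mk f = HomotopyGroup.mk g := by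
  obtain ⟨H⟩ := h
  -- The corner 1 maps to the base point of the torus, which `H` fixes; so `γ` can be glued in at
  -- every time.
  have hH1 : ∀ s, H (s, torusParam _ 1) = y := fun s => by
    rw [torusParam_one, H.eq_fst s rfl, ← torusParam_zero, hf]
    exact f.2 _ ⟨0, .inl rfl⟩
  obtain ⟨γ, hγ : HomotopyGroup.mk γ = (HomotopyGroup.mk f)⁻¹⟩ :=
    Quotient.exists_rep (s := GenLoop.Homotopic.setoid (Fin (m + 1)) y)
      ((HomotopyGroup.mk f)⁻¹ : HomotopyGroup (Fin (m + 1)) Y y)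
  have hfγ : HomotopyGroup.mk (GenLoop.cornerGlue f γ) = 1 := by
    rw [HomotopyGroup.mk_cornerGlue, hγ]
    exact inv_mul_cancel _
  have hgγ : HomotopyGroup.mk (GenLoop.cornerGlue g γ) = 1 := by
    refine (Quotient.sound ?_ : HomotopyGroup.mk GenLoop.const = _).symm
    obtain ⟨A⟩ : GenLoop.Homotopic GenLoop.const (GenLoop.cornerGlue f γ) :=
      Quotient.exact hfγ.symm
    -- Concatenate the null-homotopy `A` of `f` glued with `γ` and the homotopy `H` glued with a
    -- fixed `γ`. Both run through maps of the torus, though the second need not be constant on the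
    -- faces.
    refine homotopicRel_const_of_homotopicWith_factorsThrough (GenLoop.cornerGlue g γ).2
      (ContinuousMap.HomotopicWith.trans (g := (GenLoop.cornerGlue f γ).1) ⟨⟨A.toHomotopy, ?_⟩⟩ ⟨
        { toFun := fun z => cornerGlue (fun u => H (z.1, torusParam _ u)) γ z.2
          continuous_toFun := continuous_cornerGlue
            (F := fun z : I × (Fin (m + 1) → I) => H (z.1, torusParam _ z.2)) (by fun_prop) hH1 γ
          map_zero_left := fun u => by simp only [H.apply_zero, hf]; rfl
          map_one_left := fun u => by simp only [H.apply_one, hg]; rfl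
          prop' := fun s => cornerGlue_factorsThrough
            (F := fun u => H (s, torusParam _ u))
            (fun u v h => congrArg (fun t => H (s, t)) h) (hH1 s) γ }⟩)
    intro s
    exact GenLoop.factorsThrough_torusParam (y := y)
      ⟨⟨fun u => A (s, u), by fun_prop⟩, fun u hu => A.eq_fst s hu⟩
  rw [HomotopyGroup.mk_cornerGlue] at hfγ hgγ
  exact mul_left_cancel (hfγ.trans hgγ.symm)

/-- The map `π_{m+1}(Y) → [𝕋ᵐ⁺¹, Y]` induced by the collapse of the codimension one skeleton is
injective. -/
theorem precomp_torusTopProj_piEquiv_injective (m : ℕ) {Y : Type*} [TopologicalSpace Y] (y : Y) :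
    Function.Injective fun a : HomotopyGroup (Fin (m + 1)) Y y =>
      (precomp (torusTopProj (m + 1)) rfl (piEquiv m y a) :
        PtdClasses (Torus (m + 1)) 0 Y y) := by
  rintro ⟨f⟩ ⟨g⟩ h
  have hc := cubeToTorusTop_isCollapse m
  exact HomotopyGroup.mk_eq_of_torus_homotopicRel f g
    ((hc.lift f).comp (torusTopProj (m + 1))) ((hc.lift g).comp (torusTopProj (m + 1)))
    (hc.lift_apply f) (hc.lift_apply g) (Quotient.exact h)

/-! ### Comparing loops on a sphere with the cube modulo its boundary -/

/-- Openness of a set is continuity of its indicator into `Prop`, and continuity descends along the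
product because `Z` is locally compact. -/
theorem isQuotientMap_prodMap_id {X B Z : Type*} [TopologicalSpace X] [TopologicalSpace B]
    [TopologicalSpace Z] [LocallyCompactSpace Z] {π : X → B} (hπ : IsQuotientMap π) :
    IsQuotientMap (Prod.map π (id : Z → Z)) := by
  refine ⟨isCoinducing_iff.2 fun s => ⟨fun hs => ?_, fun hs =>
    hs.preimage (hπ.continuous.prodMap continuous_id)⟩,
    hπ.surjective.prodMap Function.surjective_id⟩
  rw [isOpen_iff_continuous_mem] at hs ⊢
  exact hπ.continuous_lift_prod_left hs

/-- The quotient map `[0,1]ᵏ⁺² → 𝕋ᵏ⁺¹ / (𝕋ᵏ⁺¹)⁽ᵏ⁾ × [0,1] → Σ(𝕋ᵏ⁺¹ / (𝕋ᵏ⁺¹)⁽ᵏ⁾)`. -/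
def cubeToSuspTorusTop (k : ℕ) :
    C(Fin (k + 2) → I, Susp (TorusTop (k + 1)) (TorusTop.base (k + 1))) :=
  (Susp.cyl _).comp (((cubeToTorusTop (k + 1)).prodMap (ContinuousMap.id I)).comp
    ⟨fun u => (fun i => u i.castSucc, u (Fin.last _)), by fun_prop⟩)

/-- The cube is collapsed in two stages: first the faces of the leading coordinates, then the two
ends of the last coordinate together with the base point line. -/
theorem cubeToSuspTorusTop_isCollapse (k : ℕ) :
    IsCollapse (cubeToSuspTorusTop k) (Cube.boundary (Fin (k + 2)))
      (Susp.base (TorusTop.base (k + 1))) := by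
  have hc := cubeToTorusTop_isCollapse k
  have hs := Susp.isCollapse (TorusTop.base (k + 1))
  have hbase : ∀ v, cubeToTorusTop (k + 1) v = TorusTop.base (k + 1) ↔
      v ∈ Cube.boundary (Fin (k + 1)) := by
    refine fun v => ⟨fun h => ?_, hc.map_eq v⟩
    obtain ⟨a, ha⟩ := hc.nonempty
    rcases hc.inj v a (h.trans (hc.map_eq a ha).symm) with rfl | ⟨h, -⟩
    exacts [ha, h]
  have hbd : ∀ u : Fin (k + 2) → I, u ∈ Cube.boundary (Fin (k + 2)) ↔
      (fun i : Fin (k + 1) => u i.castSucc) ∈ Cube.boundary (Fin (k + 1)) ∨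
        u (Fin.last _) = 0 ∨ u (Fin.last _) = 1 := fun u =>
    Fin.exists_fin_succ' (P := fun i => u i = 0 ∨ u i = 1)
  refine ⟨?_, ⟨0, 0, .inl rfl⟩, fun u hu => ?_, fun u v h => ?_⟩
  · let e : (Fin (k + 2) → I) ≃ₜ (Fin (k + 1) → I) × I :=
      { toFun := fun u => (fun i => u i.castSucc, u (Fin.last _))
        invFun := fun z => Fin.snoc (α := fun _ => I) z.1 z.2
        left_inv := fun u => Fin.snoc_init_self u
        right_inv := fun z => by simp
        continuous_toFun := by fun_prop
        continuous_invFun := by fun_prop }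
    exact hs.isQuotientMap.comp
      ((isQuotientMap_prodMap_id hc.isQuotientMap).comp e.isQuotientMap)
  · refine hs.map_eq _ ?_
    rcases (hbd u).1 hu with h | h
    exacts [.inl ((hbase _).2 h), .inr h]
  · rcases hs.inj _ _ h with h | ⟨h, h'⟩
    · obtain ⟨h, h'⟩ := Prod.ext_iff.1 h
      rcases hc.inj _ _ h with h | ⟨h, k⟩
      · refine .inl (funext fun i => ?_)
        induction i using Fin.lastCases with
        | last => exact h'
        | cast i => exact congrFun h i
      · exact .inr ⟨(hbd u).2 (.inl h), (hbd v).2 (.inl k)⟩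
    · exact .inr ⟨(hbd u).2 (h.imp (hbase _).1 id), (hbd v).2 (h'.imp (hbase _).1 id)⟩

/-- The identification `[𝕋ᵏ⁺¹ / (𝕋ᵏ⁺¹)⁽ᵏ⁾, ΩY] ≅ π_{k+2}(Y)`. -/
def loopPiEquiv (k : ℕ) {Y : Type*} [TopologicalSpace Y] (y : Y) :
    PtdClasses (TorusTop (k + 1)) (TorusTop.base (k + 1)) (LoopSpace Y y) (Path.refl y) ≃
      HomotopyGroup (Fin (k + 2)) Y y :=
  (loopAdj _ y).trans (((cubeToSuspTorusTop_isCollapse k).equiv y).symm.trans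
    (Quotient.congr (Equiv.refl _) (fun _ _ => Iff.rfl) :
      RelClasses (Fin (k + 2) → I) (Cube.boundary (Fin (k + 2))) Y y ≃
        HomotopyGroup (Fin (k + 2)) Y y))

/-- Both classes are represented by the same map: on the cube it evaluates `f`, at the image of the
leading coordinates, at the last coordinate as loop time. -/
theorem precomp_torusToSusp_loopAdj (k : ℕ) {Y : Type*} [TopologicalSpace Y] (y : Y)
    (a : PtdClasses (TorusTop (k + 1)) (TorusTop.base (k + 1)) (LoopSpace Y y) (Path.refl y)) :
    (precomp (torusToSusp (k + 1)) rfl (loopAdj 0 y (precomp (torusTopProj (k + 1)) rfl a)) :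
        PtdClasses (Torus (k + 2)) 0 Y y) =
      precomp (torusTopProj (k + 2)) rfl (piEquiv (k + 1) y (loopPiEquiv k y a)) := by
  obtain ⟨f⟩ := a
  -- `F`, `G` and `C` are the representatives that the adjunctions and `loopPiEquiv` produce by
  -- definition.
  let F : RelMap (Torus (k + 1) × I) {z | z.1 = 0 ∨ z.2 = 0 ∨ z.2 = 1} Y y :=
    ⟨⟨fun z => f.1 (torusTopProj (k + 1) z.1) z.2, by fun_prop⟩, by
      rintro ⟨a, t⟩ (h | h | h)
      · obtain rfl : a = 0 := h
        exact congrArg (fun γ : LoopSpace Y y => γ t) (f.2 _ rfl)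
      · obtain rfl : t = 0 := h
        simp
      · obtain rfl : t = 1 := h
        simp⟩
  let G : RelMap (TorusTop (k + 1) × I)
      {z | z.1 = TorusTop.base (k + 1) ∨ z.2 = 0 ∨ z.2 = 1} Y y :=
    ⟨⟨fun z => f.1 z.1 z.2, by fun_prop⟩, by
      rintro ⟨a, t⟩ (h | h | h)
      · exact congrArg (fun γ : LoopSpace Y y => γ t) (f.2 a h)
      · obtain rfl : t = 0 := h
        simp
      · obtain rfl : t = 1 := h
        simp⟩
  have hs := Susp.isCollapse (TorusTop.base (k + 1))
  let C : RelMap (Fin (k + 2) → I) (Cube.boundary (Fin (k + 2))) Y y :=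
    ⟨(hs.lift G).comp (cubeToSuspTorusTop k), fun u hu => by
      obtain ⟨a, ha⟩ := hs.nonempty
      exact (congrArg (hs.lift G) (((cubeToSuspTorusTop_isCollapse k).map_eq u hu).trans
        (hs.map_eq a ha).symm)).trans ((hs.lift_apply G a).trans (G.2 a ha))⟩
  refine congrArg (Quotient.mk (relSetoid (Torus (k + 2)) {0} Y y))
    (Subtype.ext (ContinuousMap.ext fun t => ?_))
  obtain ⟨u, rfl⟩ := torusParam_surjective _ t
  refine ((Susp.isCollapse (0 : Torus (k + 1))).lift_apply F
    (torusParam (k + 1) fun i => u i.castSucc, u (Fin.last _))).trans ?_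
  refine Eq.trans ?_ ((cubeToTorusTop_isCollapse (k + 1)).lift_apply C u).symm
  exact (hs.lift_apply G
    (cubeToTorusTop (k + 1) fun i => u i.castSucc, u (Fin.last _))).symm

/-! ### The case n = 1 and the conclusion -/

/-- Distinctness is vacuous for one point, so the space is ℝ³ and straight-line homotopies are
available. -/
theorem relClasses_conf_one_subsingleton {A : Type*} [TopologicalSpace A] (S : Set A)
    (q : Conf 1) : Subsingleton (RelClasses A S (Conf 1) q) := by
  refine ⟨?_⟩
  rintro ⟨f⟩ ⟨g⟩
  have hne : ∀ (x : Fin 1 → EuclideanSpace ℝ (Fin 3)) (i j : Fin 1), i ≠ j → x i ≠ x j :=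
    fun x i j h => absurd (Subsingleton.elim i j) h
  refine Quotient.sound ⟨{
    toFun := fun z => ⟨fun i => (1 - (z.1 : ℝ)) • (f.1 z.2).1 i + (z.1 : ℝ) • (g.1 z.2).1 i,
      hne _⟩
    continuous_toFun := by
      have hf : Continuous fun z : I × A => (f.1 z.2).1 := continuous_subtype_val.comp
        (f.1.continuous.comp continuous_snd)
      have hg : Continuous fun z : I × A => (g.1 z.2).1 := continuous_subtype_val.comp
        (g.1.continuous.comp continuous_snd)
      refine Continuous.subtype_mk (continuous_pi fun i => ?_) _
      have hfi := (continuous_apply i).comp hf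
      have hgi := (continuous_apply i).comp hg
      exact ((by fun_prop : Continuous fun z : I × A => 1 - (z.1 : ℝ)).smul hfi).add
        ((by fun_prop : Continuous fun z : I × A => (z.1 : ℝ)).smul hgi)
    map_zero_left := fun a => Subtype.ext (funext fun i => by simp)
    map_one_left := fun a => Subtype.ext (funext fun i => by simp)
    prop' := fun s a ha => Subtype.ext (funext fun i => ?_) }⟩
  simp only [ContinuousMap.coe_mk, f.2 a ha, g.2 a ha, ← add_smul, sub_add_cancel, one_smul]

instance torusTop_zero_subsingleton : Subsingleton (TorusTop 0) :=
  (Quotient.mk_surjective (s := collapseSetoid (torusSkeleton 0 (0 - 1)))).subsingleton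

instance ptdClasses_subsingleton {X Y : Type*} [TopologicalSpace X] [Subsingleton X] (x : X)
    [TopologicalSpace Y] (y : Y) : Subsingleton (PtdClasses X x Y y) := by
  refine ⟨?_⟩
  rintro ⟨f⟩ ⟨g⟩
  refine congrArg (Quotient.mk _) (Subtype.ext (ContinuousMap.ext fun a => ?_))
  rw [f.2 a (Subsingleton.elim _ _), g.2 a (Subsingleton.elim _ _)]

/-- The identification `π_N(ΩConf(n)) ≅ π_n(Conf(n))`. -/
def piTopEquiv : (m : ℕ) → (q : Conf (m + 1)) →
    (PiTop m q ≃ HomotopyGroup (Fin (m + 1)) (Conf (m + 1)) q)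
  -- Here `TorusTop 0` is a point rather than a 0-sphere, so no suspension argument applies; the
  -- bijection exists because both sides are singletons.
  | 0, q =>
    haveI : Subsingleton (HomotopyGroup (Fin 1) (Conf 1) q) :=
      haveI := relClasses_conf_one_subsingleton {TorusTop.base 1} q
      (piEquiv 0 q).injective.subsingleton
    { toFun := fun _ => default
      invFun := fun _ => Quotient.mk _ ⟨.const _ (Path.refl q), fun _ _ => rfl⟩
      left_inv := fun _ => Subsingleton.elim _ _
      right_inv := fun _ => Subsingleton.elim _ _ }
  | k + 1, q => loopPiEquiv k q

theorem pSharp_jTop (m : ℕ) (q : Conf (m + 1)) (a : PiTop m q) :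
    pSharp m q (jTop m q a) = collapseSharp m q (piTopEquiv m q a) :=
  match m, q, a with
  | 0, q, _ => (relClasses_conf_one_subsingleton {0} q).elim _ _
  | k + 1, q, a => precomp_torusToSusp_loopAdj k q a

end

theorem mainTheorem6 (m : ℕ) (q : Conf (m + 1)) :
    Function.Injective (pSharp m q ∘ jTop m q) ∧
      Function.Injective (collapseSharp m q) ∧
      ∃ Φ : PiTop m q ≃ HomotopyGroup (Fin (m + 1)) (Conf (m + 1)) q,
        ∀ a : PiTop m q, pSharp m q (jTop m q a) = collapseSharp m q (Φ a) := by
  have h : Function.Injective (collapseSharp m q) := precomp_torusTopProj_piEquiv_injective m q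
  refine ⟨fun a b hab => ?_, h, piTopEquiv m q, pSharp_jTop m q⟩
  simp only [Function.comp_apply, pSharp_jTop] at hab
  exact (piTopEquiv m q).injective (h hab)
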